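/- Let $G=\prod_{j=0}^{\infty}\mathbb Z_2$ be the dyadic group, with its normalized Haar measure $\mu$ (the product of the uniform probability measures on $\mathbb Z_2=\{0,1\}$). For $n\in\mathbb N=\{0,1,2,\dots\}$ and $x\in G$ let $I_n(x)=\{y\in G: y_i=x_i \text{ for all } i<n\}$, and let $\zeta_n$ be the $\sigma$-algebra generated by $\{I_n(x):x\in G\}$. For $n=\sum_{k\ge 0} n_k2^k$ with $n_k\in\{0,1\}$ let $w_n(x)=\prod_{k\ge 0}\big((-1)^{x_k}\big)^{n_k}$ be the $n$-th Walsh function. For a real- or complex-valued martingale $F=(F_n)_{n\in\mathbb N}$ with respect to $(\zeta_n)_{n\in\mathbb N}$ put $$\widehat F(k)=\lim_{n\to\infty}\int_G F_n w_k\,d\mu,\qquad S_nF=\sum_{k=0}^{n-1}\widehat F(k)w_k,\qquad \sigma_nF=\frac1n\sum_{k=1}^{n}S_kF\quad(n\ge 1).$$ With $\|f\|_{1/2}=\left(\int_G|f|^{1/2}d\mu\right)^{2}$, the martingale Hardy space $H_{1/2}(G)$ consists of all such martingales with $\|F\|_{H_{1/2}}:=\big\|\sup_{n\in\mathbb N}|F_n|\big\|_{1/2}<\infty$.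 For $s\in\mathbb N$ and $0\le k\le s-1$ let $\alpha_k^s=2^s+2^0+2^1+\dots+2^k$, and define the restricted weighted maximal operator $$\widetilde\sigma_4^{*,\nabla}F:=\sup_{s\in\mathbb N}\ \sup_{0\le k\le s-1}\frac{|\sigma_{\alpha_k^s}F|}{\log^2\alpha_k^s}.$$ Then $\widetilde\sigma_4^{*,\nabla}$ is bounded from $H_{1/2}(G)$ to $L_{1/2}(G)$: there is a constant $c<\infty$ such that for every $F\in H_{1/2}(G)$ the function $\widetilde\sigma_4^{*,\nabla}F$ belongs to $L_{1/2}(G)$ and $$\big\|\widetilde\sigma_4^{*,\nabla}F\big\|_{1/2}\le c\,\|F\|_{H_{1/2}}.$$ -/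

import Mathlib

open MeasureTheory ProbabilityTheory Filter
open scoped ENNReal NNReal Topology

noncomputable section

namespace WalshFejer

/-- The dyadic group: the countable product of copies of the cyclic group of order two.
A point is a sequence `x = (x 0, x 1, …)`. -/
abbrev DyadicGroup : Type := ℕ → ZMod 2

/-- The normalized Haar measure on the dyadic group: the product of the measures on the factors
that give mass `1/2` to each point. -/
def haarG : Measure DyadicGroup :=
  Measure.infinitePi fun _ : ℕ => (PMF.uniformOfFintype (ZMod 2)).toMeasure

instance instIsProbabilityMeasureHaarG : IsProbabilityMeasure haarG := by
  unfold haarG; infer_instance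

/-- The dyadic interval `I_n(x)` of rank `n` around `x`. -/
def dyadicInterval (n : ℕ) (x : DyadicGroup) : Set DyadicGroup :=
  {y | ∀ i < n, y i = x i}

theorem finite_range_dyadicInterval (n : ℕ) : (Set.range (dyadicInterval n)).Finite := by
  have h : Set.range (dyadicInterval n) ⊆ Set.range
      (fun v : Fin n → ZMod 2 => {y : DyadicGroup | ∀ i : Fin n, y i = v i}) := by
    rintro _ ⟨x, rfl⟩
    refine ⟨fun i => x i, ?_⟩
    ext y
    exact ⟨fun hy i hi => hy ⟨i, hi⟩, fun hy i => hy i i.2⟩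
  exact (Set.finite_range _).subset h

theorem measurableSet_dyadicInterval (n : ℕ) (x : DyadicGroup) :
    MeasurableSet (dyadicInterval n x) := by
  have h : dyadicInterval n x = ⋂ i ∈ Set.Iio n, (fun y : DyadicGroup => y i) ⁻¹' {x i} := by
    ext y; simp [dyadicInterval]
  rw [h]
  exact MeasurableSet.biInter (Set.to_countable _)
    fun i _ => measurable_pi_apply i (MeasurableSet.singleton _)

/-- The filtration of the dyadic group whose `n`-th sigma-algebra is generated by the dyadic
intervals of rank `n`. -/
def dyadicFiltration :
    Filtration ℕ (MeasurableSpace.pi : MeasurableSpace DyadicGroup) where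
  seq n := MeasurableSpace.generateFrom (Set.range (dyadicInterval n))
  mono' := by
    intro n m hnm
    refine MeasurableSpace.generateFrom_le ?_
    rintro _ ⟨x, rfl⟩
    have h : dyadicInterval n x = ⋃₀ (dyadicInterval m '' dyadicInterval n x) := by
      ext y
      constructor
      · intro hy
        exact ⟨_, ⟨y, hy, rfl⟩, fun i _ => rfl⟩
      · rintro ⟨_, ⟨z, hz, rfl⟩, hy⟩ i hi
        rw [hy i (lt_of_lt_of_le hi hnm), hz i hi]
    rw [h]
    refine MeasurableSet.sUnion
      (((finite_range_dyadicInterval m).subset (Set.image_subset_range _ _)).countable) ?_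
    rintro _ ⟨z, _, rfl⟩
    exact MeasurableSpace.measurableSet_generateFrom ⟨z, rfl⟩
  le' := by
    intro n
    refine MeasurableSpace.generateFrom_le ?_
    rintro _ ⟨x, rfl⟩
    exact measurableSet_dyadicInterval n x

/-- The Rademacher functions `r_k(x) = (-1)^(x_k)`. -/
def rademacher (k : ℕ) (x : DyadicGroup) : ℝ := (-1) ^ (x k).val

/-- The Walsh functions `w_n = ∏ r_k^(n_k)`, where the `n_k` are the binary digits of `n`
(which vanish for `k` at least the number `n.size` of binary digits). -/
def walsh (n : ℕ) (x : DyadicGroup) : ℝ :=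
  ∏ k ∈ Finset.range n.size, rademacher k x ^ (n.testBit k).toNat

variable {𝕜 : Type*} [RCLike 𝕜]

/-- The Walsh–Fourier coefficients of a martingale: the limit of `∫ F_n w_k` as `n → ∞`. -/
def walshCoeff (F : ℕ → DyadicGroup → 𝕜) (k : ℕ) : 𝕜 :=
  limUnder atTop fun n : ℕ => ∫ x, walsh k x • F n x ∂haarG

/-- The `n`-th partial sum `S_n F` of the Walsh–Fourier series. -/
def partialSum (F : ℕ → DyadicGroup → 𝕜) (n : ℕ) (x : DyadicGroup) : 𝕜 :=
  ∑ k ∈ Finset.range n, walsh k x • walshCoeff F k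

/-- The `n`-th Fejér mean `σ_n F = (1/n) ∑_{k=1}^n S_k F`. -/
def fejerMean (F : ℕ → DyadicGroup → 𝕜) (n : ℕ) (x : DyadicGroup) : 𝕜 :=
  (n : 𝕜)⁻¹ * ∑ k ∈ Finset.Icc 1 n, partialSum F k x

/-- The martingale Hardy (quasi-)norm: the `L_p` (quasi-)norm of `sup_n |F_n|`. -/
def hardyNorm (p : ℝ≥0∞) (F : ℕ → DyadicGroup → 𝕜) : ℝ≥0∞ :=
  eLpNorm (fun x => ⨆ n : ℕ, ‖F n x‖ₑ) p haarG

/-- Membership in the martingale Hardy space `H_p`. -/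
def MemHardy (p : ℝ≥0∞) (F : ℕ → DyadicGroup → 𝕜) : Prop :=
  Martingale F dyadicFiltration haarG ∧ hardyNorm p F < ∞

/-- The numbers `α_k^s = 2^s + 2^0 + 2^1 + … + 2^k`. -/
def alpha (s k : ℕ) : ℕ := 2 ^ s + ∑ i ∈ Finset.range (k + 1), 2 ^ i

/-- The weighted restricted maximal operator
`F ↦ sup_s sup_{0 ≤ k ≤ s - 1} |σ_{α_k^s} F| / log² α_k^s`, with values in `[0, ∞]`. -/
def weightedMaximal (F : ℕ → DyadicGroup → 𝕜) (x : DyadicGroup) : ℝ≥0∞ :=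
  ⨆ s : ℕ, ⨆ k : ℕ, ⨆ _ : k < s,
    ENNReal.ofReal (‖fejerMean F (alpha s k) x‖ / Real.log (alpha s k) ^ 2)

end WalshFejer

end

namespace WalshFejer

/-! ### Walsh functions and the dyadic kernels -/

/-! The argument works with square roots, needs no atomic decomposition, and bounds the supremum
pointwise by one series that is linear in increments of the maximal function. Since `alpha s k` is
`2 ^ s` plus one less than a power of two, its Fejér kernel is controlled by the kernels of orders
`2 ^ s` and `2 ^ (k + 1)`, and each of these by a positive sum of indicators of the translates
$I_i(x+e_j)$, $j\le i$ (`abs_fejerSum_alpha_le`).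

The mean of order `alpha s k` sees only $F_{s+1}$. Put $g=|F_{s+1}|^{1/2}$, which is constant on
intervals of rank $s+1$. A reverse Hölder inequality replaces averages of $g^2$ by squares of
averages of $g$, at a cost that the kernel weights turn into $2^{-(i-j)/2}$. Hence $|\sigma
F|^{1/2}$ is at most a multiple of two operators `shiftAvg` applied to $g$
(`enorm_fejerMean_alpha_le`), and these are bounded on $L_1$ uniformly in the rank.

To take the supremum, bound $g$ by $\sum_{m\le s+1}\delta_m$, where $\delta_m\ge0$ are the
increments of the running maximum of $|F_n|^{1/2}$. As $\delta_m$ is constant on intervals of rank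
$m$, `shiftAvg k` of it is, for every $k$, at most a constant times the sum of the `shiftAvg i` with
$i\le m$ (`shiftAvg_le_sum`). The square root of the weight is of order $1/s\lesssim 1/(m+1)$, so
the bound no longer depends on $s$ or $k$. On integration the $m+1$ ranks cancel the factor
$1/(m+1)$, and the integrals of the $\delta_m$ telescope to that of $(\sup_n|F_n|)^{1/2}$. -/

theorem walsh_eq_prod_range {n N : ℕ} (h : n < 2 ^ N) (x : DyadicGroup) :
    walsh n x = ∏ k ∈ Finset.range N, rademacher k x ^ (n.testBit k).toNat := by
  unfold walsh
  refine Finset.prod_subset (Finset.range_mono (Nat.size_le.2 h)) fun k _ hk => ?_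
  rw [Nat.testBit_eq_false_of_lt (Nat.size_le.1 (by simpa using hk))]
  simp

theorem walsh_zero (x : DyadicGroup) : walsh 0 x = 1 := by simp [walsh]

theorem walsh_two_pow_add {s j : ℕ} (h : j < 2 ^ s) (x : DyadicGroup) :
    walsh (2 ^ s + j) x = rademacher s x * walsh j x := by
  rw [walsh_eq_prod_range (N := s + 1) (by rw [pow_succ]; omega), Finset.prod_range_succ,
    walsh_eq_prod_range h, Nat.testBit_two_pow_add_eq, Nat.testBit_eq_false_of_lt h, mul_comm]
  congr 1
  · simp
  · refine Finset.prod_congr rfl fun i hi => ?_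
    rw [Nat.testBit_two_pow_add_gt (Finset.mem_range.1 hi)]

theorem zmod_two_eq_zero_or_one : ∀ a : ZMod 2, a = 0 ∨ a = 1 := by decide

theorem rademacher_eq_ite (k : ℕ) (x : DyadicGroup) :
    rademacher k x = if x k = 0 then 1 else -1 := by
  unfold rademacher
  rcases zmod_two_eq_zero_or_one (x k) with h | h <;> simp [h, ZMod.val_one]

theorem abs_rademacher (k : ℕ) (x : DyadicGroup) : |rademacher k x| = 1 := by
  rw [rademacher_eq_ite]; split_ifs <;> simp

theorem measurable_rademacher (k : ℕ) : Measurable (rademacher k) := by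
  have : Measurable fun a : ZMod 2 => (-1 : ℝ) ^ a.val := measurable_of_countable _
  exact this.comp (measurable_pi_apply k)

theorem measurable_walsh (n : ℕ) : Measurable (walsh n) :=
  Finset.measurable_prod _ fun k _ => (measurable_rademacher k).pow_const _

theorem abs_walsh (n : ℕ) (x : DyadicGroup) : |walsh n x| = 1 := by
  rw [walsh, Finset.abs_prod]
  exact Finset.prod_eq_one fun k _ => by rw [abs_pow, abs_rademacher, one_pow]

theorem one_add_rademacher_mul (k : ℕ) (x y : DyadicGroup) :
    1 + rademacher k x * rademacher k y = 2 * if y k = x k then 1 else 0 := by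
  rw [rademacher_eq_ite, rademacher_eq_ite]
  rcases zmod_two_eq_zero_or_one (x k) with h | h <;>
    rcases zmod_two_eq_zero_or_one (y k) with h' | h' <;> norm_num [h, h']

/-- The Dirichlet kernel `D_n(x - y)`. -/
noncomputable def dirichletKernel (n : ℕ) (x y : DyadicGroup) : ℝ :=
  ∑ i ∈ Finset.range n, walsh i x * walsh i y

/-- The sum `D_1 + … + D_n` of Dirichlet kernels, evaluated at `x - y`. -/
noncomputable def fejerSum (n : ℕ) (x y : DyadicGroup) : ℝ :=
  ∑ j ∈ Finset.range n, dirichletKernel (j + 1) x y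

theorem dirichletKernel_two_pow_add {s j : ℕ} (h : j ≤ 2 ^ s) (x y : DyadicGroup) :
    dirichletKernel (2 ^ s + j) x y =
      dirichletKernel (2 ^ s) x y + rademacher s x * rademacher s y * dirichletKernel j x y := by
  unfold dirichletKernel
  rw [Finset.sum_range_add, Finset.mul_sum]
  congr 1
  refine Finset.sum_congr rfl fun i hi => ?_
  have hi : i < 2 ^ s := lt_of_lt_of_le (Finset.mem_range.1 hi) h
  rw [walsh_two_pow_add hi, walsh_two_pow_add hi]
  ring

theorem fejerSum_two_pow_add {s m : ℕ} (h : m ≤ 2 ^ s) (x y : DyadicGroup) :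
    fejerSum (2 ^ s + m) x y = fejerSum (2 ^ s) x y + m * dirichletKernel (2 ^ s) x y
      + rademacher s x * rademacher s y * fejerSum m x y := by
  unfold fejerSum
  rw [Finset.sum_range_add, Finset.mul_sum, add_assoc]
  congr 1
  have hm : (m : ℝ) * dirichletKernel (2 ^ s) x y
      = ∑ _i ∈ Finset.range m, dirichletKernel (2 ^ s) x y := by simp
  rw [hm, ← Finset.sum_add_distrib]
  refine Finset.sum_congr rfl fun i hi => ?_
  rw [add_assoc, dirichletKernel_two_pow_add (by have := Finset.mem_range.1 hi; omega)]

/-! ### Translations, interval indicators and kernels of order a power of two -/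

/-- The translation `x ↦ x + e_j`. -/
def shift (j : ℕ) (x : DyadicGroup) : DyadicGroup := x + Pi.single j 1

theorem shift_apply_of_ne {i j : ℕ} (h : i ≠ j) (x : DyadicGroup) : shift j x i = x i := by
  simp [shift, h]

theorem shift_apply_self (j : ℕ) (x : DyadicGroup) : shift j x j = x j + 1 := by
  simp [shift]

theorem measurable_shift (j : ℕ) : Measurable (shift j) := by
  refine measurable_pi_lambda _ fun i => ?_
  exact (measurable_of_countable fun a : ZMod 2 => a + (Pi.single j 1 : DyadicGroup) i).comp
    (measurable_pi_apply i)

theorem dyadicInterval_congr {n : ℕ} {x y : DyadicGroup} (h : ∀ i < n, x i = y i) :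
    dyadicInterval n x = dyadicInterval n y := by
  ext z
  exact ⟨fun hz i hi => (hz i hi).trans (h i hi), fun hz i hi => (hz i hi).trans (h i hi).symm⟩

theorem dyadicInterval_shift_of_le {n j : ℕ} (h : n ≤ j) (x : DyadicGroup) :
    dyadicInterval n (shift j x) = dyadicInterval n x :=
  dyadicInterval_congr fun i hi => shift_apply_of_ne (by omega) x

/-- The indicator of `y ∈ I_n(x)`. -/
noncomputable def intervalInd (n : ℕ) (x y : DyadicGroup) : ℝ := (dyadicInterval n x).indicator 1 y

theorem intervalInd_nonneg (n : ℕ) (x y : DyadicGroup) : 0 ≤ intervalInd n x y :=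
  Set.indicator_nonneg (fun _ _ => zero_le_one) _

theorem intervalInd_zero (x y : DyadicGroup) : intervalInd 0 x y = 1 := by
  simp [intervalInd, dyadicInterval]

theorem intervalInd_succ (n : ℕ) (x y : DyadicGroup) :
    intervalInd (n + 1) x y = (if y n = x n then 1 else 0) * intervalInd n x y := by
  classical
  have hmem : y ∈ dyadicInterval (n + 1) x ↔ y n = x n ∧ y ∈ dyadicInterval n x :=
    Nat.forall_lt_succ_right.trans and_comm
  simp only [intervalInd, Set.indicator_apply, hmem, Pi.one_apply]
  by_cases h : y n = x n <;> simp [h]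

theorem intervalInd_shift_of_le {n j : ℕ} (h : n ≤ j) (x y : DyadicGroup) :
    intervalInd n (shift j x) y = intervalInd n x y := by
  rw [intervalInd, dyadicInterval_shift_of_le h, intervalInd]

theorem intervalInd_eq_add (n : ℕ) (x y : DyadicGroup) :
    intervalInd n x y = intervalInd (n + 1) x y + intervalInd (n + 1) (shift n x) y := by
  rw [intervalInd_succ, intervalInd_succ, intervalInd_shift_of_le le_rfl, shift_apply_self,
    ← add_mul]
  rcases zmod_two_eq_zero_or_one (x n) with h | h <;>
    rcases zmod_two_eq_zero_or_one (y n) with h' | h' <;>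
    simp [h, h', CharTwo.add_self_eq_zero]

theorem dirichletKernel_two_pow (k : ℕ) (x y : DyadicGroup) :
    dirichletKernel (2 ^ k) x y = 2 ^ k * intervalInd k x y := by
  induction k with
  | zero => simp [dirichletKernel, walsh_zero, intervalInd_zero]
  | succ k ih =>
    rw [pow_succ, mul_two, dirichletKernel_two_pow_add le_rfl, ← one_add_mul,
      one_add_rademacher_mul, ih, intervalInd_succ]
    ring

/-- A positive kernel which dominates the dyadic Fejér kernel. -/
noncomputable def shiftKernel (k : ℕ) (x y : DyadicGroup) : ℝ :=
  ∑ j ∈ Finset.range (k + 1), 2 ^ (j + k) * intervalInd k (shift j x) y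

theorem two_pow_mul_intervalInd_le_shiftKernel (k : ℕ) (x y : DyadicGroup) :
    2 ^ (k + k) * intervalInd k x y ≤ shiftKernel k x y := by
  rw [← intervalInd_shift_of_le (le_refl k) x y]
  exact Finset.single_le_sum
    (f := fun j => (2 : ℝ) ^ (j + k) * intervalInd k (shift j x) y)
    (fun j _ => mul_nonneg (by positivity) (intervalInd_nonneg _ _ _))
    (Finset.self_mem_range_succ k)

/-- Doubling the order multiplies the kernel by $1+r_k(x)r_k(y)$, which is $2$ or $0$ and cuts each
$I_k(x+e_j)$, $j<k$, down to $I_{k+1}(x+e_j)$, and adds $4^k$ on $I_k(x)$. That interval splits into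
$I_{k+1}(x)$ and $I_{k+1}(x+e_k)$, which are the last two terms of the next dominating kernel. -/
theorem fejerSum_two_pow_bounds (k : ℕ) (x y : DyadicGroup) :
    0 ≤ fejerSum (2 ^ k) x y ∧ fejerSum (2 ^ k) x y ≤ shiftKernel k x y := by
  induction k with
  | zero => simp [fejerSum, dirichletKernel, walsh_zero, shiftKernel, intervalInd_zero]
  | succ k ih =>
    have e : fejerSum (2 ^ (k + 1)) x y = (2 * if y k = x k then 1 else 0) * fejerSum (2 ^ k) x y
        + 2 ^ k * (2 ^ k * intervalInd k x y) := by
      rw [pow_succ, mul_two, fejerSum_two_pow_add le_rfl, ← one_add_rademacher_mul,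
        dirichletKernel_two_pow]
      push_cast
      ring
    have hδ : (0 : ℝ) ≤ 2 * if y k = x k then 1 else 0 := by split_ifs <;> norm_num
    have hI := intervalInd_nonneg k x y
    refine ⟨by rw [e]; have := ih.1; positivity, ?_⟩
    have key : (2 * if y k = x k then 1 else 0) * shiftKernel k x y =
        ∑ j ∈ Finset.range k, 2 ^ (j + (k + 1)) * intervalInd (k + 1) (shift j x) y
          + 2 * 2 ^ (k + k) * intervalInd (k + 1) x y := by
      rw [shiftKernel, Finset.mul_sum, Finset.sum_range_succ, intervalInd_shift_of_le le_rfl,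
        intervalInd_succ k x y]
      congr 1
      · refine Finset.sum_congr rfl fun j hj => ?_
        rw [intervalInd_succ, shift_apply_of_ne (Finset.mem_range.1 hj).ne']
        ring
      · ring
    rw [e]
    refine (add_le_add_left (mul_le_mul_of_nonneg_left ih.2 hδ) _).trans ?_
    rw [key, shiftKernel, Finset.sum_range_succ, Finset.sum_range_succ,
      intervalInd_shift_of_le (le_refl (k + 1)), intervalInd_eq_add k x y]
    have h1 := intervalInd_nonneg (k + 1) x y
    have h2 := intervalInd_nonneg (k + 1) (shift k x) y
    have e2 : (2 : ℝ) ^ (k + (k + 1)) = 2 * (2 ^ k * 2 ^ k) := by ring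
    have e3 : (2 : ℝ) ^ (k + 1 + (k + 1)) = 4 * (2 ^ k * 2 ^ k) := by ring
    have e4 : (2 : ℝ) ^ (k + k) = 2 ^ k * 2 ^ k := by ring
    rw [e2, e3, e4]
    have hp : (0 : ℝ) ≤ 2 ^ k * 2 ^ k := by positivity
    nlinarith [mul_nonneg hp h1, mul_nonneg hp h2]

theorem alpha_eq (s k : ℕ) : alpha s k = 2 ^ s + (2 ^ (k + 1) - 1) := by
  rw [alpha, Nat.geomSum_eq le_rfl]; simp

theorem alpha_lt {s k : ℕ} (h : k < s) : alpha s k < 2 ^ (s + 1) := by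
  have h1 : 2 ^ (k + 1) ≤ 2 ^ s := Nat.pow_le_pow_right (by norm_num) h
  have h2 : 0 < 2 ^ (k + 1) := by positivity
  rw [alpha_eq, pow_succ 2 s]; omega

/-- The special form of the index enters here: the part of the kernel left after removing $2^s$ has
order $m=2^{k+1}-1$, hence is the kernel sum of order $2^{k+1}$ minus a single Dirichlet kernel,
itself an interval indicator. -/
theorem abs_fejerSum_alpha_le {s k : ℕ} (h : k < s) (x y : DyadicGroup) :
    |fejerSum (alpha s k) x y| ≤ 2 * (shiftKernel s x y + shiftKernel (k + 1) x y) := by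
  have h1 : 2 ^ (k + 1) ≤ 2 ^ s := Nat.pow_le_pow_right (by norm_num) h
  obtain ⟨m, hm⟩ : ∃ m, 2 ^ (k + 1) = m + 1 :=
    Nat.exists_eq_succ_of_ne_zero (by positivity)
  have hlast : fejerSum m x y
      = fejerSum (2 ^ (k + 1)) x y - dirichletKernel (2 ^ (k + 1)) x y := by
    rw [hm, fejerSum, fejerSum, Finset.sum_range_succ]; ring
  have hms : (m : ℝ) ≤ 2 ^ s := by
    have : m ≤ 2 ^ s := by omega
    exact_mod_cast this
  rw [alpha_eq, hm, Nat.add_sub_cancel, fejerSum_two_pow_add (by omega), hlast,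
    dirichletKernel_two_pow, dirichletKernel_two_pow]
  obtain ⟨a1, a2⟩ := fejerSum_two_pow_bounds s x y
  obtain ⟨b1, b2⟩ := fejerSum_two_pow_bounds (k + 1) x y
  have a3 := two_pow_mul_intervalInd_le_shiftKernel s x y
  have b3 := two_pow_mul_intervalInd_le_shiftKernel (k + 1) x y
  have ia := intervalInd_nonneg s x y
  have ib := intervalInd_nonneg (k + 1) x y
  rw [pow_add] at a3 b3
  have a4 : m * (2 ^ s * intervalInd s x y) ≤ shiftKernel s x y := by
    refine le_trans ?_ a3
    rw [mul_assoc]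
    gcongr
  have a5 : 0 ≤ m * (2 ^ s * intervalInd s x y) := by positivity
  have b4 : 2 ^ (k + 1) * intervalInd (k + 1) x y ≤ shiftKernel (k + 1) x y := by
    refine le_trans ?_ b3
    gcongr
    exact le_mul_of_one_le_left (by positivity) (one_le_pow₀ (by norm_num))
  have b5 : 0 ≤ 2 ^ (k + 1) * intervalInd (k + 1) x y := by positivity
  have hr : |rademacher s x * rademacher s y| = 1 := by simp [abs_mul, abs_rademacher]
  refine (abs_add_le _ _).trans ?_
  rw [abs_mul, hr, one_mul, abs_of_nonneg (by linarith)]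
  have : |fejerSum (2 ^ (k + 1)) x y - 2 ^ (k + 1) * intervalInd (k + 1) x y|
      ≤ shiftKernel (k + 1) x y := abs_le.2 ⟨by linarith, by linarith⟩
  linarith [this.trans' (abs_nonneg _)]

/-! ### Averages over dyadic intervals -/

theorem haarG_dyadicInterval (n : ℕ) (x : DyadicGroup) :
    haarG (dyadicInterval n x) = (2 ^ n)⁻¹ := by
  have h : dyadicInterval n x = Set.pi (Finset.range n) fun i => {x i} := by
    ext y; simp [dyadicInterval]
  rw [h, haarG, Measure.infinitePi_pi _ fun i _ => MeasurableSet.singleton _]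
  simp [ENNReal.inv_pow]

theorem measurableSet_mem_dyadicInterval (n : ℕ) :
    MeasurableSet {p : DyadicGroup × DyadicGroup | p.2 ∈ dyadicInterval n p.1} := by
  have h : {p : DyadicGroup × DyadicGroup | p.2 ∈ dyadicInterval n p.1}
      = ⋂ i ∈ Set.Iio n, {p | p.2 i = p.1 i} := by
    ext p; simp [dyadicInterval]
  rw [h]
  exact MeasurableSet.biInter (Set.to_countable _) fun i _ =>
    measurableSet_eq_fun ((measurable_pi_apply i).comp measurable_snd)
      ((measurable_pi_apply i).comp measurable_fst)

/-- The average of `f` over the dyadic interval `I_n(x)`. -/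
noncomputable def dyadicAvg (n : ℕ) (f : DyadicGroup → ℝ≥0∞) (x : DyadicGroup) : ℝ≥0∞ :=
  2 ^ n * ∫⁻ y in dyadicInterval n x, f y ∂haarG

theorem dyadicAvg_shift_of_le {n j : ℕ} (h : n ≤ j) (f : DyadicGroup → ℝ≥0∞) (x : DyadicGroup) :
    dyadicAvg n f (shift j x) = dyadicAvg n f x := by
  rw [dyadicAvg, dyadicInterval_shift_of_le h, dyadicAvg]

theorem dyadicAvg_mono (n : ℕ) {f g : DyadicGroup → ℝ≥0∞} (h : ∀ y, f y ≤ g y)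
    (x : DyadicGroup) : dyadicAvg n f x ≤ dyadicAvg n g x := by
  unfold dyadicAvg; gcongr; exact h _

theorem dyadicAvg_finset_sum {ι : Type*} (n : ℕ) (t : Finset ι) {f : ι → DyadicGroup → ℝ≥0∞}
    (hf : ∀ i, Measurable (f i)) (x : DyadicGroup) :
    dyadicAvg n (fun y => ∑ i ∈ t, f i y) x = ∑ i ∈ t, dyadicAvg n (f i) x := by
  simp only [dyadicAvg]
  rw [lintegral_finsetSum _ fun i _ => hf i, Finset.mul_sum]

theorem two_pow_mul_inv_cancel (n : ℕ) : (2 : ℝ≥0∞) ^ n * (2 ^ n)⁻¹ = 1 :=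
  ENNReal.mul_inv_cancel (by positivity) (by finiteness)

theorem dyadicAvg_eq_self {n : ℕ} {f : DyadicGroup → ℝ≥0∞} {x : DyadicGroup}
    (h : ∀ y ∈ dyadicInterval n x, f y = f x) : dyadicAvg n f x = f x := by
  rw [dyadicAvg, setLIntegral_congr_fun (measurableSet_dyadicInterval n x) h,
    setLIntegral_const, haarG_dyadicInterval, mul_left_comm, two_pow_mul_inv_cancel, mul_one]

theorem lintegral_dyadicInterval_eq (n : ℕ) (f : DyadicGroup → ℝ≥0∞) (x : DyadicGroup) :
    ∫⁻ y in dyadicInterval n x, f y ∂haarG = ∫⁻ y, {p : DyadicGroup × DyadicGroup |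
      p.2 ∈ dyadicInterval n p.1}.indicator (fun p => f p.2) (x, y) ∂haarG := by
  rw [← lintegral_indicator (measurableSet_dyadicInterval n x)]
  rfl

theorem measurable_dyadicAvg (n : ℕ) {f : DyadicGroup → ℝ≥0∞} (hf : Measurable f) :
    Measurable (dyadicAvg n f) := by
  unfold dyadicAvg
  simp only [lintegral_dyadicInterval_eq]
  exact (((hf.comp measurable_snd).indicator
    (measurableSet_mem_dyadicInterval n)).lintegral_prod_right').const_mul _

/-- Tonelli, with the symmetry $y\in I_n(x+e_j)\iff x\in I_n(y+e_j)$, which holds because $e_j$ has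
order two. -/
theorem lintegral_dyadicAvg_shift (n j : ℕ) {f : DyadicGroup → ℝ≥0∞} (hf : Measurable f) :
    ∫⁻ x, dyadicAvg n f (shift j x) ∂haarG = ∫⁻ x, f x ∂haarG := by
  have hm : Measurable fun p : DyadicGroup × DyadicGroup =>
      {p : DyadicGroup × DyadicGroup | p.2 ∈ dyadicInterval n p.1}.indicator
        (fun p => f p.2) (shift j p.1, p.2) :=
    ((hf.comp measurable_snd).indicator (measurableSet_mem_dyadicInterval n)).comp
      (((measurable_shift j).comp measurable_fst).prodMk measurable_snd)
  have hmem : ∀ x y, y ∈ dyadicInterval n (shift j x) ↔ x ∈ dyadicInterval n (shift j y) := by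
    have key : ∀ x y, y ∈ dyadicInterval n (shift j x) → x ∈ dyadicInterval n (shift j y) := by
      intro x y h i hi
      rcases eq_or_ne i j with rfl | hij
      · rw [shift_apply_self, h i hi, shift_apply_self, add_assoc, CharTwo.add_self_eq_zero,
          add_zero]
      · rw [shift_apply_of_ne hij, h i hi, shift_apply_of_ne hij]
    exact fun x y => ⟨key x y, key y x⟩
  simp only [dyadicAvg, lintegral_dyadicInterval_eq]
  rw [lintegral_const_mul _ hm.lintegral_prod_right', lintegral_lintegral_swap hm.aemeasurable,
    ← lintegral_const_mul _ hm.lintegral_prod_left']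
  refine lintegral_congr fun y => ?_
  have : ∀ x, {p : DyadicGroup × DyadicGroup | p.2 ∈ dyadicInterval n p.1}.indicator
      (fun p => f p.2) (shift j x, y)
        = (dyadicInterval n (shift j y)).indicator (fun _ => f y) x := by
    intro x
    by_cases h : x ∈ dyadicInterval n (shift j y)
    · rw [Set.indicator_of_mem h]
      exact Set.indicator_of_mem (s := {p : DyadicGroup × DyadicGroup |
        p.2 ∈ dyadicInterval n p.1}) ((hmem x y).2 h) _
    · rw [Set.indicator_of_notMem h]
      exact Set.indicator_of_notMem (s := {p : DyadicGroup × DyadicGroup |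
        p.2 ∈ dyadicInterval n p.1}) (fun h' => h ((hmem x y).1 h')) _
  simp only [this]
  rw [lintegral_indicator (measurableSet_dyadicInterval _ _), setLIntegral_const,
    haarG_dyadicInterval, mul_left_comm, two_pow_mul_inv_cancel, mul_one]

/-- A reverse Hölder inequality for functions that are constant on the dyadic intervals of
rank `n`. -/
theorem dyadicAvg_sq_le {k n : ℕ} (hkn : k ≤ n) {g : DyadicGroup → ℝ≥0∞} (hg : Measurable g)
    (hc : ∀ x, ∀ y ∈ dyadicInterval n x, g y = g x) (x : DyadicGroup) :
    dyadicAvg k (fun y => g y ^ 2) x ≤ 2 ^ (n - k) * dyadicAvg k g x ^ 2 := by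
  -- The value $g(y)$ is its own average over $I_n(y)\subseteq I_k(x)$, and enlarging the domain
  -- costs the ratio of the measures.
  have hsup : ∀ y ∈ dyadicInterval k x, g y ≤ 2 ^ (n - k) * dyadicAvg k g x := by
    intro y hy
    rw [← dyadicAvg_eq_self (hc y), dyadicAvg, dyadicAvg, ← mul_assoc, ← pow_add,
      Nat.sub_add_cancel hkn]
    gcongr
    exact fun z hz i hi => (hz i (hi.trans_le hkn)).trans (hy i hi)
  calc dyadicAvg k (fun y => g y ^ 2) x
      ≤ 2 ^ k * ∫⁻ y in dyadicInterval k x, (2 ^ (n - k) * dyadicAvg k g x) * g y ∂haarG := by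
        rw [dyadicAvg]
        refine mul_le_mul_right (setLIntegral_mono' (measurableSet_dyadicInterval k x)
          fun y hy => ?_) _
        rw [sq]
        exact mul_le_mul_left (hsup y hy) _
    _ = 2 ^ (n - k) * dyadicAvg k g x ^ 2 := by
        rw [lintegral_const_mul _ hg, mul_left_comm, ← dyadicAvg]
        ring

/-! ### Weighted averages over translates -/

/-- The number `2^{-1/2}`. -/
noncomputable def invSqrtTwo : ℝ≥0∞ := 2⁻¹ ^ (1 / 2 : ℝ)

theorem invSqrtTwo_sq : invSqrtTwo ^ 2 = 2⁻¹ := by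
  rw [invSqrtTwo, ← ENNReal.rpow_natCast, ← ENNReal.rpow_mul]; norm_num

theorem invSqrtTwo_lt_one : invSqrtTwo < 1 :=
  ENNReal.rpow_lt_one (by norm_num) (by norm_num)

/-- The sum of the geometric series of ratio `2^{-1/2}`. -/
noncomputable def geomConst : ℝ≥0∞ := (1 - invSqrtTwo)⁻¹

theorem geomConst_ne_top : geomConst ≠ ∞ :=
  ENNReal.inv_ne_top.2 (tsub_pos_of_lt invSqrtTwo_lt_one).ne'

theorem sum_pow_le_geomConst (t : Finset ℕ) (k : ℕ) (h : ∀ j ∈ t, j ≤ k) :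
    ∑ j ∈ t, invSqrtTwo ^ (k - j) ≤ geomConst := by
  rw [geomConst, ← ENNReal.tsum_geometric, ← Finset.sum_image (f := fun i => invSqrtTwo ^ i)
    (g := fun j => k - j)]
  · exact ENNReal.sum_le_tsum _
  · intro a ha b hb hab
    have := h a ha; have := h b hb
    simp only at hab
    omega

/-- A weighted sum of averages over the translates `I_k(x + e_j)`, `j ≤ k`. -/
noncomputable def shiftAvg (k : ℕ) (f : DyadicGroup → ℝ≥0∞) (x : DyadicGroup) : ℝ≥0∞ :=
  ∑ j ∈ Finset.range (k + 1), invSqrtTwo ^ (k - j) * dyadicAvg k f (shift j x)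

theorem shiftAvg_mono (k : ℕ) {f g : DyadicGroup → ℝ≥0∞} (h : ∀ y, f y ≤ g y)
    (x : DyadicGroup) : shiftAvg k f x ≤ shiftAvg k g x := by
  unfold shiftAvg; gcongr; exact dyadicAvg_mono _ h _

theorem shiftAvg_finset_sum {ι : Type*} (k : ℕ) (t : Finset ι) {f : ι → DyadicGroup → ℝ≥0∞}
    (hf : ∀ i, Measurable (f i)) (x : DyadicGroup) :
    shiftAvg k (fun y => ∑ i ∈ t, f i y) x = ∑ i ∈ t, shiftAvg k (f i) x := by
  simp only [shiftAvg, dyadicAvg_finset_sum k t hf, Finset.mul_sum]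
  exact Finset.sum_comm

theorem measurable_shiftAvg (k : ℕ) {f : DyadicGroup → ℝ≥0∞} (hf : Measurable f) :
    Measurable (shiftAvg k f) :=
  Finset.measurable_fun_sum _ fun j _ =>
    ((measurable_dyadicAvg k hf).comp (measurable_shift j)).const_mul _

theorem lintegral_shiftAvg_le (k : ℕ) {f : DyadicGroup → ℝ≥0∞} (hf : Measurable f) :
    ∫⁻ x, shiftAvg k f x ∂haarG ≤ geomConst * ∫⁻ x, f x ∂haarG := by
  have hm : ∀ j, Measurable fun x => dyadicAvg k f (shift j x) := fun j =>
    (measurable_dyadicAvg k hf).comp (measurable_shift j)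
  unfold shiftAvg
  rw [lintegral_finsetSum _ fun j _ => (hm j).const_mul _]
  simp only [lintegral_const_mul _ (hm _), lintegral_dyadicAvg_shift k _ hf, ← Finset.sum_mul]
  gcongr
  exact sum_pow_le_geomConst _ _ fun j hj => Finset.mem_range_succ_iff.1 hj

/-- Averaging at a rank at least $m$ does nothing to `f`. For $j<m$ the weights only decrease from
rank $m$ to rank $k$; for $j\ge m$ the shift leaves `f` unchanged, so these terms sum geometrically
to a multiple of `f x`. -/
theorem shiftAvg_le_of_le {k m : ℕ} (hmk : m ≤ k) {f : DyadicGroup → ℝ≥0∞}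
    (hc : ∀ x, ∀ y ∈ dyadicInterval m x, f y = f x) (x : DyadicGroup) :
    shiftAvg k f x ≤ (1 + geomConst) * shiftAvg m f x := by
  have havg : ∀ n, m ≤ n → ∀ z, dyadicAvg n f z = f z := fun n hn z =>
    dyadicAvg_eq_self fun y hy => hc z y fun i hi => hy i (hi.trans_le hn)
  have hself : f x ≤ shiftAvg m f x := by
    have h := Finset.single_le_sum
      (f := fun j => invSqrtTwo ^ (m - j) * dyadicAvg m f (shift j x))
      (fun j _ => zero_le) (Finset.self_mem_range_succ m)
    simp only [Nat.sub_self, pow_zero, one_mul, dyadicAvg_shift_of_le (le_refl m)] at h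
    rwa [havg m le_rfl] at h
  have hsplit : shiftAvg k f x
      = ∑ j ∈ Finset.range m, invSqrtTwo ^ (k - j) * f (shift j x)
        + ∑ j ∈ Finset.Ico m (k + 1), invSqrtTwo ^ (k - j) * f (shift j x) := by
    rw [shiftAvg, Finset.sum_range_add_sum_Ico _ (by omega)]
    exact Finset.sum_congr rfl fun j _ => by rw [havg k hmk]
  rw [hsplit, add_mul, one_mul]
  refine add_le_add ?_ ?_
  · rw [shiftAvg, Finset.sum_range_succ]
    refine le_add_right (Finset.sum_le_sum fun j _ => ?_)
    rw [havg m le_rfl]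
    exact mul_le_mul_left (pow_le_pow_of_le_one zero_le invSqrtTwo_lt_one.le (by omega)) _
  · calc ∑ j ∈ Finset.Ico m (k + 1), invSqrtTwo ^ (k - j) * f (shift j x)
        = (∑ j ∈ Finset.Ico m (k + 1), invSqrtTwo ^ (k - j)) * f x := by
          rw [Finset.sum_mul]
          refine Finset.sum_congr rfl fun j hj => ?_
          rw [hc x (shift j x) fun i hi => shift_apply_of_ne
            (by have := (Finset.mem_Ico.1 hj).1; omega) x]
      _ ≤ geomConst * shiftAvg m f x := by
          gcongr
          exact sum_pow_le_geomConst _ _ fun j hj => by have := (Finset.mem_Ico.1 hj).2; omega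

/-- The right side is free of `k`, so a supremum over all ranks costs only a sum over $m+1$ of them.
-/
theorem shiftAvg_le_sum (k m : ℕ) {f : DyadicGroup → ℝ≥0∞}
    (hc : ∀ x, ∀ y ∈ dyadicInterval m x, f y = f x) (x : DyadicGroup) :
    shiftAvg k f x ≤ (1 + geomConst) * ∑ i ∈ Finset.range (m + 1), shiftAvg i f x := by
  have hs : ∀ i ≤ m, shiftAvg i f x ≤ ∑ i ∈ Finset.range (m + 1), shiftAvg i f x := fun i hi =>
    Finset.single_le_sum (f := fun i => shiftAvg i f x) (fun j _ => zero_le)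
      (Finset.mem_range_succ_iff.2 hi)
  rcases le_total m k with h | h
  · exact (shiftAvg_le_of_le h hc x).trans (by gcongr; exact hs m le_rfl)
  · exact (hs k h).trans (le_mul_of_one_le_left zero_le le_self_add)

theorem sum_sq_le_sq_sum (t : Finset ℕ) (a : ℕ → ℝ≥0∞) :
    ∑ j ∈ t, a j ^ 2 ≤ (∑ j ∈ t, a j) ^ 2 := by
  rw [sq, Finset.sum_mul]
  refine Finset.sum_le_sum fun j hj => ?_
  rw [sq]
  exact mul_le_mul_right (Finset.single_le_sum (fun i _ => zero_le) hj) _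

theorem sum_two_pow_mul_dyadicAvg_le {k n : ℕ} (hkn : k ≤ n) {g : DyadicGroup → ℝ≥0∞}
    (hg : Measurable g) (hc : ∀ x, ∀ y ∈ dyadicInterval n x, g y = g x) (x : DyadicGroup) :
    ∑ j ∈ Finset.range (k + 1), 2 ^ j * dyadicAvg k (fun y => g y ^ 2) (shift j x)
      ≤ 2 ^ n * shiftAvg k g x ^ 2 := by
  calc ∑ j ∈ Finset.range (k + 1), 2 ^ j * dyadicAvg k (fun y => g y ^ 2) (shift j x)
      ≤ ∑ j ∈ Finset.range (k + 1),
          2 ^ n * (invSqrtTwo ^ (k - j) * dyadicAvg k g (shift j x)) ^ 2 := by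
        refine Finset.sum_le_sum fun j hj => ?_
        have hj : j ≤ k := Finset.mem_range_succ_iff.1 hj
        -- The kernel weight times the reverse Hölder loss is $2^n\,2^{-(k-j)}$, a square up to the
        -- factor $2^n$.
        have e : (2 : ℝ≥0∞) ^ j * 2 ^ (n - k) = 2 ^ n * (invSqrtTwo ^ (k - j)) ^ 2 := by
          rw [← pow_mul, mul_comm (k - j), pow_mul, invSqrtTwo_sq, ← ENNReal.inv_pow]
          have : n = j + (n - k) + (k - j) := by omega
          conv_rhs => rw [this, pow_add, mul_assoc, two_pow_mul_inv_cancel, mul_one]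
          rw [pow_add]
        rw [mul_pow, ← mul_assoc, ← e, mul_assoc]
        exact mul_le_mul_right (dyadicAvg_sq_le hkn hg hc _) _
    _ ≤ 2 ^ n * shiftAvg k g x ^ 2 := by
        rw [← Finset.mul_sum]
        exact mul_le_mul_right (sum_sq_le_sq_sum _ _) _

/-! ### Martingales with respect to the dyadic filtration -/

/-- The intervals of rank $n$ are the atoms of the $n$-th σ-algebra: no measurable set separates two
points of one interval. -/
theorem eq_of_measurable_dyadicFiltration {β : Type*} [MeasurableSpace β]
    [MeasurableSingletonClass β] {n : ℕ} {f : DyadicGroup → β}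
    (hf : Measurable[dyadicFiltration n] f) (x : DyadicGroup) :
    ∀ y ∈ dyadicInterval n x, f y = f x := by
  intro y hy
  have key : ∀ S, MeasurableSet[dyadicFiltration n] S → (y ∈ S ↔ x ∈ S) := by
    intro S hS
    induction S, hS using MeasurableSpace.generateFrom_induction with
    | hC t ht _ =>
      obtain ⟨z, rfl⟩ := ht
      exact ⟨fun h i hi => (hy i hi).symm.trans (h i hi), fun h i hi => (hy i hi).trans (h i hi)⟩
    | empty => simp
    | compl t _ ih => simp [ih]
    | iUnion s _ ih => simp [ih]
  exact (key _ (hf (measurableSet_singleton (f x)))).2 rfl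

theorem measurable_dyadicFiltration_of_eq {β : Type*} [MeasurableSpace β] {n : ℕ}
    {f : DyadicGroup → β} (hf : ∀ x, ∀ y ∈ dyadicInterval n x, f y = f x) :
    Measurable[dyadicFiltration n] f := by
  intro S _
  have h : f ⁻¹' S = ⋃₀ (dyadicInterval n '' (f ⁻¹' S)) := by
    ext y
    constructor
    · intro hy
      exact ⟨_, ⟨y, hy, rfl⟩, fun i _ => rfl⟩
    · rintro ⟨_, ⟨z, hz, rfl⟩, hy⟩
      rw [Set.mem_preimage, hf z y hy]
      exact hz
  rw [h]
  refine MeasurableSet.sUnion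
    (((finite_range_dyadicInterval n).subset (Set.image_subset_range _ _)).countable) ?_
  rintro _ ⟨z, _, rfl⟩
  exact MeasurableSpace.measurableSet_generateFrom ⟨z, rfl⟩

theorem measurable_dyadicFiltration_walsh {k N : ℕ} (h : k < 2 ^ N) :
    Measurable[dyadicFiltration N] (walsh k) := by
  refine measurable_dyadicFiltration_of_eq fun x y hy => ?_
  rw [walsh_eq_prod_range h, walsh_eq_prod_range h]
  refine Finset.prod_congr rfl fun i hi => ?_
  rw [rademacher, rademacher, hy i (Finset.mem_range.1 hi)]

variable {𝕜 : Type*} [RCLike 𝕜]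

/-! ### Fejér means as integral operators -/

theorem integrable_walsh_smul (k : ℕ) {f : DyadicGroup → 𝕜} (hf : Integrable f haarG) :
    Integrable (fun x => walsh k x • f x) haarG := by
  refine hf.bdd_smul 1 (measurable_walsh k).aestronglyMeasurable ?_
  exact ae_of_all _ fun x => by rw [Real.norm_eq_abs, abs_walsh]

/-- Since `walsh k` is measurable at level `N`, it can be pulled out of the conditional expectation
of `F n`; the limit defining the coefficient is therefore eventually constant. -/
theorem integral_walsh_smul_eq {F : ℕ → DyadicGroup → 𝕜}
    (hF : Martingale F dyadicFiltration haarG) {k N n : ℕ} (hk : k < 2 ^ N) (hn : N ≤ n) :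
    ∫ x, walsh k x • F n x ∂haarG = ∫ x, walsh k x • F N x ∂haarG := by
  rw [← integral_condExp (dyadicFiltration.le N)]
  refine integral_congr_ae ?_
  have h := condExp_smul_of_aestronglyMeasurable_left (μ := haarG) (m := dyadicFiltration N)
    (measurable_dyadicFiltration_walsh hk).stronglyMeasurable.aestronglyMeasurable
    (integrable_walsh_smul k (hF.integrable n)) (hF.integrable n)
  refine h.trans ?_
  filter_upwards [hF.condExp_ae_eq hn] with x hx
  rw [Pi.smul_apply', hx]

theorem walshCoeff_eq {F : ℕ → DyadicGroup → 𝕜}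
    (hF : Martingale F dyadicFiltration haarG) {k N : ℕ} (hk : k < 2 ^ N) :
    walshCoeff F k = ∫ x, walsh k x • F N x ∂haarG := by
  refine Tendsto.limUnder_eq (tendsto_atTop_of_eventually_const (i₀ := N) fun n hn => ?_)
  exact integral_walsh_smul_eq hF hk hn

theorem integrable_dirichletKernel_smul (n : ℕ) (x : DyadicGroup) {f : DyadicGroup → 𝕜}
    (hf : Integrable f haarG) :
    Integrable (fun y => dirichletKernel n x y • f y) haarG := by
  simp only [dirichletKernel, Finset.sum_smul, mul_smul]
  exact integrable_finsetSum _ fun i _ => (integrable_walsh_smul i hf).fun_smul _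

theorem partialSum_eq_integral {F : ℕ → DyadicGroup → 𝕜}
    (hF : Martingale F dyadicFiltration haarG) {n N : ℕ} (hn : n ≤ 2 ^ N) (x : DyadicGroup) :
    partialSum F n x = ∫ y, dirichletKernel n x y • F N y ∂haarG := by
  simp only [dirichletKernel, Finset.sum_smul, mul_smul]
  rw [integral_finsetSum _ fun i _ => (integrable_walsh_smul i (hF.integrable N)).fun_smul _]
  refine Finset.sum_congr rfl fun i hi => ?_
  rw [integral_smul, walshCoeff_eq hF (lt_of_lt_of_le (Finset.mem_range.1 hi) hn)]

theorem fejerMean_eq_integral {F : ℕ → DyadicGroup → 𝕜}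
    (hF : Martingale F dyadicFiltration haarG) {n N : ℕ} (hn : n ≤ 2 ^ N) (x : DyadicGroup) :
    fejerMean F n x = (n : 𝕜)⁻¹ * ∫ y, fejerSum n x y • F N y ∂haarG := by
  simp only [fejerSum, Finset.sum_smul]
  rw [integral_finsetSum _ fun i _ => integrable_dirichletKernel_smul _ x (hF.integrable N),
    fejerMean, Finset.range_eq_Ico, Finset.sum_Ico_add' (fun i => ∫ y, dirichletKernel i x y •
      F N y ∂haarG) 0 n 1]
  congr 1
  refine Finset.sum_congr (by ext; simp) fun i hi => ?_
  exact partialSum_eq_integral hF (by have := (Finset.mem_Icc.1 hi).2; omega) x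

theorem lintegral_shiftKernel_mul (k : ℕ) (x : DyadicGroup) {h : DyadicGroup → ℝ≥0∞}
    (hh : Measurable h) :
    ∫⁻ y, ENNReal.ofReal (shiftKernel k x y) * h y ∂haarG
      = ∑ j ∈ Finset.range (k + 1), 2 ^ j * dyadicAvg k h (shift j x) := by
  have e : ∀ y, ENNReal.ofReal (shiftKernel k x y) * h y = ∑ j ∈ Finset.range (k + 1),
      2 ^ (j + k) * (dyadicInterval k (shift j x)).indicator h y := by
    intro y
    rw [shiftKernel, ENNReal.ofReal_sum_of_nonneg fun j _ =>
      mul_nonneg (by positivity) (intervalInd_nonneg _ _ _), Finset.sum_mul]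
    refine Finset.sum_congr rfl fun j _ => ?_
    rw [ENNReal.ofReal_mul (by positivity), ENNReal.ofReal_pow (by norm_num),
      ENNReal.ofReal_ofNat, mul_assoc, intervalInd]
    by_cases hy : y ∈ dyadicInterval k (shift j x) <;> simp [hy]
  simp only [e]
  have hm : ∀ j, Measurable ((dyadicInterval k (shift j x)).indicator h) := fun _ =>
    hh.indicator (measurableSet_dyadicInterval _ _)
  rw [lintegral_finsetSum _ fun j _ => (hm j).const_mul _]
  refine Finset.sum_congr rfl fun j _ => ?_
  rw [lintegral_const_mul _ (hm j), lintegral_indicator (measurableSet_dyadicInterval _ _),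
    pow_add, mul_assoc, ← dyadicAvg]

theorem shiftKernel_nonneg (k : ℕ) (x y : DyadicGroup) : 0 ≤ shiftKernel k x y :=
  Finset.sum_nonneg fun j _ => mul_nonneg (by positivity) (intervalInd_nonneg _ _ _)

theorem measurable_shiftKernel (k : ℕ) (x : DyadicGroup) : Measurable (shiftKernel k x) :=
  Finset.measurable_fun_sum _ fun _ _ =>
    (measurable_one.indicator (measurableSet_dyadicInterval _ _)).const_mul _

theorem enorm_inv_alpha_le (s k : ℕ) : ‖((alpha s k : ℕ) : 𝕜)⁻¹‖ₑ ≤ (2 ^ s)⁻¹ := by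
  have h : ((2 : ℝ≥0∞) ^ s)⁻¹ = ENNReal.ofReal ((2 ^ s)⁻¹) := by
    rw [ENNReal.ofReal_inv_of_pos (by positivity), ENNReal.ofReal_pow (by norm_num),
      ENNReal.ofReal_ofNat]
  have hα : ((2 ^ s : ℕ) : ℝ) ≤ alpha s k := by exact_mod_cast Nat.le_add_right _ _
  rw [h, ← ofReal_norm, norm_inv, RCLike.norm_natCast]
  push_cast at hα
  exact ENNReal.ofReal_le_ofReal (inv_anti₀ (by positivity) hα)

/-- The square root of the modulus of a function. -/
noncomputable def sqrtNorm (f : DyadicGroup → 𝕜) (x : DyadicGroup) : ℝ≥0∞ :=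
  ‖f x‖ₑ ^ (1 / 2 : ℝ)

theorem sqrtNorm_sq (f : DyadicGroup → 𝕜) (x : DyadicGroup) : sqrtNorm f x ^ 2 = ‖f x‖ₑ := by
  rw [sqrtNorm, ← ENNReal.rpow_natCast, ← ENNReal.rpow_mul]; norm_num

theorem measurable_sqrtNorm {f : DyadicGroup → 𝕜} (hf : Measurable f) :
    Measurable (sqrtNorm f) := hf.enorm.pow_const _

/-- Level $s+1$ suffices because `alpha s k` is below $2^{s+1}$. The reverse Hölder factor $2^{s+1}$
is then cancelled, up to $2$, by the normalisation of the mean. -/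
theorem enorm_fejerMean_alpha_le {F : ℕ → DyadicGroup → 𝕜}
    (hF : Martingale F dyadicFiltration haarG) {s k : ℕ} (hk : k < s) (x : DyadicGroup) :
    ‖fejerMean F (alpha s k) x‖ₑ ≤ (2 * (shiftAvg s (sqrtNorm (F (s + 1))) x
      + shiftAvg (k + 1) (sqrtNorm (F (s + 1))) x)) ^ 2 := by
  have hc : ∀ x, ∀ y ∈ dyadicInterval (s + 1) x,
      sqrtNorm (F (s + 1)) y = sqrtNorm (F (s + 1)) x := fun x y hy => by
    rw [sqrtNorm, sqrtNorm,
      eq_of_measurable_dyadicFiltration (hF.stronglyMeasurable (s + 1)).measurable x y hy]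
  have hm : Measurable (F (s + 1)) :=
    (hF.stronglyMeasurable (s + 1)).measurable.mono (dyadicFiltration.le _) le_rfl
  set g := sqrtNorm (F (s + 1)) with hg
  have hgm : Measurable g := measurable_sqrtNorm hm
  have hker : ∀ y, ‖fejerSum (alpha s k) x y • F (s + 1) y‖ₑ
      ≤ 2 * (ENNReal.ofReal (shiftKernel s x y) * g y ^ 2
        + ENNReal.ofReal (shiftKernel (k + 1) x y) * g y ^ 2) := by
    intro y
    rw [enorm_smul, ← sqrtNorm_sq (F (s + 1)), ← hg, ← add_mul, ← mul_assoc,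
      ← ENNReal.ofReal_add (shiftKernel_nonneg _ _ _) (shiftKernel_nonneg _ _ _)]
    refine mul_le_mul_left ?_ _
    rw [← ofReal_norm, Real.norm_eq_abs, ← ENNReal.ofReal_ofNat 2,
      ← ENNReal.ofReal_mul (by norm_num)]
    exact ENNReal.ofReal_le_ofReal (abs_fejerSum_alpha_le hk x y)
  have hint : ∀ i, Measurable fun y => ENNReal.ofReal (shiftKernel i x y) * g y ^ 2 := fun i =>
    (measurable_shiftKernel i x).ennreal_ofReal.mul (hgm.pow_const 2)
  have hadd : ∀ i j, Measurable fun y => ENNReal.ofReal (shiftKernel i x y) * g y ^ 2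
      + ENNReal.ofReal (shiftKernel j x y) * g y ^ 2 := fun i j => (hint i).add (hint j)
  calc ‖fejerMean F (alpha s k) x‖ₑ
      ≤ (2 ^ s)⁻¹ * ∫⁻ y, ‖fejerSum (alpha s k) x y • F (s + 1) y‖ₑ ∂haarG := by
        rw [fejerMean_eq_integral hF (alpha_lt hk).le, enorm_mul]
        exact mul_le_mul' (enorm_inv_alpha_le s k) (enorm_integral_le_lintegral_enorm _)
    _ ≤ (2 ^ s)⁻¹ * (2 * (2 ^ (s + 1) * shiftAvg s g x ^ 2
          + 2 ^ (s + 1) * shiftAvg (k + 1) g x ^ 2)) := by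
        refine mul_le_mul_right ((lintegral_mono hker).trans ?_) _
        rw [lintegral_const_mul _ (hadd _ _), lintegral_add_left (hint _),
          lintegral_shiftKernel_mul _ _ (hgm.pow_const 2),
          lintegral_shiftKernel_mul _ _ (hgm.pow_const 2)]
        refine mul_le_mul_right (add_le_add ?_ ?_) _
        · exact sum_two_pow_mul_dyadicAvg_le (by omega) hgm hc x
        · exact sum_two_pow_mul_dyadicAvg_le (by omega) hgm hc x
    _ = 4 * (shiftAvg s g x ^ 2 + shiftAvg (k + 1) g x ^ 2) := by
        have e : ((2 : ℝ≥0∞) ^ s)⁻¹ * (2 * (2 ^ (s + 1) * shiftAvg s g x ^ 2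
          + 2 ^ (s + 1) * shiftAvg (k + 1) g x ^ 2))
          = (2 ^ s * (2 ^ s)⁻¹) * (4 * (shiftAvg s g x ^ 2 + shiftAvg (k + 1) g x ^ 2)) := by
          ring
        rw [e, two_pow_mul_inv_cancel, one_mul]
    _ ≤ (2 * (shiftAvg s g x + shiftAvg (k + 1) g x)) ^ 2 := by
        have e : (2 * (shiftAvg s g x + shiftAvg (k + 1) g x)) ^ 2
            = 4 * (shiftAvg s g x ^ 2 + shiftAvg (k + 1) g x ^ 2)
              + 8 * (shiftAvg s g x * shiftAvg (k + 1) g x) := by ring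
        rw [e]
        exact le_self_add

/-! ### The maximal estimate -/

/-- The increments of a sequence, starting with its first term. -/
noncomputable def increment (M : ℕ → ℝ≥0∞) : ℕ → ℝ≥0∞
  | 0 => M 0
  | n + 1 => M (n + 1) - M n

theorem sum_increment {M : ℕ → ℝ≥0∞} (hM : Monotone M) (n : ℕ) :
    ∑ m ∈ Finset.range (n + 1), increment M m = M n := by
  induction n with
  | zero => simp [increment]
  | succ n ih =>
    rw [Finset.sum_range_succ, ih, increment, add_tsub_cancel_of_le (hM n.le_succ)]

theorem tsum_increment_le {M : ℕ → ℝ≥0∞} (hM : Monotone M) {a : ℝ≥0∞} (h : ∀ n, M n ≤ a) :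
    ∑' m, increment M m ≤ a := by
  rw [ENNReal.tsum_eq_iSup_nat]
  refine iSup_le fun n => ?_
  cases n with
  | zero => simp
  | succ n => rw [sum_increment hM]; exact h n

/-- The running maximum of `|F_n|^{1/2}`. -/
noncomputable def runningMax (F : ℕ → DyadicGroup → 𝕜) (x : DyadicGroup) (n : ℕ) : ℝ≥0∞ :=
  ⨆ i, ⨆ _ : i ≤ n, sqrtNorm (F i) x

theorem monotone_runningMax (F : ℕ → DyadicGroup → 𝕜) (x : DyadicGroup) :
    Monotone (runningMax F x) := fun _ _ h => biSup_mono fun _ hi => hi.trans h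

/-- The increments of the running maximum of `|F_n|^{1/2}`. -/
noncomputable def maxIncrement (F : ℕ → DyadicGroup → 𝕜) (m : ℕ) (x : DyadicGroup) : ℝ≥0∞ :=
  increment (runningMax F x) m

theorem sqrtNorm_le_sum_maxIncrement (F : ℕ → DyadicGroup → 𝕜) (n : ℕ) (x : DyadicGroup) :
    sqrtNorm (F n) x ≤ ∑ m ∈ Finset.range (n + 1), maxIncrement F m x := by
  simp only [maxIncrement]
  rw [sum_increment (monotone_runningMax F x)]
  exact le_iSup₂ (f := fun i _ => sqrtNorm (F i) x) n le_rfl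

theorem measurable_runningMax {F : ℕ → DyadicGroup → 𝕜} (hF : ∀ n, Measurable (F n)) (n : ℕ) :
    Measurable fun x => runningMax F x n :=
  Measurable.iSup fun i => Measurable.iSup fun _ => measurable_sqrtNorm (hF i)

theorem measurable_maxIncrement {F : ℕ → DyadicGroup → 𝕜} (hF : ∀ n, Measurable (F n)) (m : ℕ) :
    Measurable (maxIncrement F m) := by
  cases m with
  | zero => exact measurable_runningMax hF 0
  | succ m => exact (measurable_runningMax hF (m + 1)).sub (measurable_runningMax hF m)

/-- Adaptedness of the increments is what allows `shiftAvg_le_sum` to be applied to each one at its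
own level. -/
theorem maxIncrement_eq {F : ℕ → DyadicGroup → 𝕜}
    (hF : ∀ n x, ∀ y ∈ dyadicInterval n x, F n y = F n x) (m : ℕ) (x : DyadicGroup) :
    ∀ y ∈ dyadicInterval m x, maxIncrement F m y = maxIncrement F m x := by
  intro y hy
  have h : ∀ n ≤ m, runningMax F y n = runningMax F x n := fun n hn =>
    iSup_congr fun i => iSup_congr fun hi => by
      rw [sqrtNorm, sqrtNorm, hF i x y fun l hl => hy l (by omega)]
  cases m with
  | zero => exact h 0 le_rfl
  | succ m =>
    rw [maxIncrement, maxIncrement, increment, increment, h _ le_rfl, h m m.le_succ]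

/-- The function that dominates the square root of the weighted maximal operator. -/
noncomputable def maximalBound (F : ℕ → DyadicGroup → 𝕜) (x : DyadicGroup) : ℝ≥0∞ :=
  ∑' m : ℕ, 3 * ((m + 1 : ℕ) : ℝ≥0∞)⁻¹ *
    ((1 + geomConst) * ∑ i ∈ Finset.range (m + 1), shiftAvg i (maxIncrement F m) x)

/-- Each of the $m+1$ inner terms has integral at most a constant times that of the increment, so
the weight $1/(m+1)$ exactly absorbs their number. -/
theorem lintegral_maximalBound_le {F : ℕ → DyadicGroup → 𝕜} (hF : ∀ n, Measurable (F n)) :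
    ∫⁻ x, maximalBound F x ∂haarG ≤ 3 * (1 + geomConst) * geomConst *
      ∫⁻ x, (⨆ n, ‖F n x‖ₑ) ^ (1 / 2 : ℝ) ∂haarG := by
  have hδ := measurable_maxIncrement hF
  have hQ : ∀ m i, Measurable (shiftAvg i (maxIncrement F m)) := fun m i =>
    measurable_shiftAvg i (hδ m)
  have hS : ∀ m, Measurable fun x => ∑ i ∈ Finset.range (m + 1),
      shiftAvg i (maxIncrement F m) x := fun m => Finset.measurable_fun_sum _ fun i _ => hQ m i
  unfold maximalBound
  rw [lintegral_tsum fun m => (((hS m).const_mul _).const_mul _).aemeasurable]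
  calc _ ≤ ∑' m : ℕ, 3 * (1 + geomConst) * geomConst * ∫⁻ x, maxIncrement F m x ∂haarG := by
        refine ENNReal.tsum_le_tsum fun m => ?_
        rw [lintegral_const_mul _ ((hS m).const_mul _), lintegral_const_mul _ (hS m),
          lintegral_finsetSum _ fun i _ => hQ m i]
        have h1 : ∑ i ∈ Finset.range (m + 1), ∫⁻ x, shiftAvg i (maxIncrement F m) x ∂haarG
            ≤ ((m + 1 : ℕ) : ℝ≥0∞) * (geomConst * ∫⁻ x, maxIncrement F m x ∂haarG) := by
          refine (Finset.sum_le_sum fun i _ => lintegral_shiftAvg_le i (hδ m)).trans_eq ?_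
          simp
        calc _ ≤ 3 * ((m + 1 : ℕ) : ℝ≥0∞)⁻¹ * ((1 + geomConst) *
              (((m + 1 : ℕ) : ℝ≥0∞) * (geomConst * ∫⁻ x, maxIncrement F m x ∂haarG))) := by
              gcongr
          _ = (((m + 1 : ℕ) : ℝ≥0∞) * ((m + 1 : ℕ) : ℝ≥0∞)⁻¹) * (3 * (1 + geomConst) * geomConst
              * ∫⁻ x, maxIncrement F m x ∂haarG) := by ring
          _ = _ := by
              rw [ENNReal.mul_inv_cancel (by simp) (by finiteness), one_mul]
    _ ≤ _ := by
        rw [ENNReal.tsum_mul_left, ← lintegral_tsum fun m => (hδ m).aemeasurable]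
        refine mul_le_mul_right (lintegral_mono fun x => ?_) _
        refine tsum_increment_le (monotone_runningMax F x) fun n => iSup₂_le fun i _ => ?_
        exact ENNReal.rpow_le_rpow (le_iSup (fun n => ‖F n x‖ₑ) i) (by norm_num)

theorem inv_mul_shiftAvg_le_maximalBound {F : ℕ → DyadicGroup → 𝕜}
    (hF : Martingale F dyadicFiltration haarG) {s : ℕ} (hs : 1 ≤ s) (k : ℕ) (x : DyadicGroup) :
    (s : ℝ≥0∞)⁻¹ * shiftAvg k (sqrtNorm (F (s + 1))) x ≤ maximalBound F x := by
  have hm : ∀ n, Measurable (F n) := fun n =>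
    (hF.stronglyMeasurable n).measurable.mono (dyadicFiltration.le _) le_rfl
  have hc := maxIncrement_eq fun n =>
    eq_of_measurable_dyadicFiltration (hF.stronglyMeasurable n).measurable
  calc (s : ℝ≥0∞)⁻¹ * shiftAvg k (sqrtNorm (F (s + 1))) x
      ≤ (s : ℝ≥0∞)⁻¹ * ∑ m ∈ Finset.range (s + 2), shiftAvg k (maxIncrement F m) x := by
        rw [← shiftAvg_finset_sum k _ (measurable_maxIncrement hm)]
        exact mul_le_mul_right (shiftAvg_mono k (sqrtNorm_le_sum_maxIncrement F (s + 1)) x) _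
    _ ≤ ∑ m ∈ Finset.range (s + 2), 3 * ((m + 1 : ℕ) : ℝ≥0∞)⁻¹ *
          ((1 + geomConst) * ∑ i ∈ Finset.range (m + 1), shiftAvg i (maxIncrement F m) x) := by
        rw [Finset.mul_sum]
        refine Finset.sum_le_sum fun m hms => mul_le_mul' ?_ (shiftAvg_le_sum k m (hc m) x)
        -- Here $m\le s+1$, and $s+2\le 3s$ because $s\ge1$; this is the source of the $3$ in
        -- `maximalBound`.
        have h : m + 1 ≤ 3 * s := by have := Finset.mem_range.1 hms; omega
        have h' : ((m + 1 : ℕ) : ℝ≥0∞) ≤ 3 * s := by exact_mod_cast h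
        calc (s : ℝ≥0∞)⁻¹ = 3 * (3 * (s : ℝ≥0∞))⁻¹ := by
              rw [ENNReal.mul_inv (by simp) (by simp), ← mul_assoc,
                ENNReal.mul_inv_cancel (by simp) (by simp), one_mul]
          _ ≤ _ := by gcongr
    _ ≤ maximalBound F x := ENNReal.sum_le_tsum _

theorem div_log_alpha_sq_le {a : ℝ} (ha : 0 ≤ a) {s : ℕ} (hs : 1 ≤ s) (k : ℕ) :
    a / Real.log (alpha s k) ^ 2 ≤ (2 * (s : ℝ)⁻¹) ^ 2 * a := by
  have hs' : (0 : ℝ) < s := by exact_mod_cast hs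
  have hα : ((2 : ℝ) ^ s) ≤ alpha s k := by exact_mod_cast Nat.le_add_right _ _
  have hlog : (s : ℝ) / 2 ≤ Real.log (alpha s k) := by
    calc (s : ℝ) / 2 ≤ s * Real.log 2 := by nlinarith [Real.log_two_gt_d9]
      _ = Real.log (2 ^ s) := by rw [Real.log_pow]
      _ ≤ _ := Real.log_le_log (by positivity) hα
  calc a / Real.log (alpha s k) ^ 2 ≤ a / ((s : ℝ) / 2) ^ 2 := by gcongr
    _ = _ := by field_simp

theorem weightedMaximal_le {F : ℕ → DyadicGroup → 𝕜}
    (hF : Martingale F dyadicFiltration haarG) (x : DyadicGroup) :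
    weightedMaximal F x ≤ (8 * maximalBound F x) ^ 2 := by
  refine iSup_le fun s => iSup_le fun k => iSup_le fun hk => ?_
  -- The index $s=0$ contributes nothing, since no $k<0$ exists.
  have hs : 1 ≤ s := by omega
  have hs' : (0 : ℝ) < s := by exact_mod_cast hs
  calc ENNReal.ofReal (‖fejerMean F (alpha s k) x‖ / Real.log (alpha s k) ^ 2)
      ≤ ENNReal.ofReal ((2 * (s : ℝ)⁻¹) ^ 2 * ‖fejerMean F (alpha s k) x‖) :=
        ENNReal.ofReal_le_ofReal (div_log_alpha_sq_le (norm_nonneg _) hs k)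
    _ = (2 * (s : ℝ≥0∞)⁻¹) ^ 2 * ‖fejerMean F (alpha s k) x‖ₑ := by
        rw [ENNReal.ofReal_mul (by positivity), ENNReal.ofReal_pow (by positivity),
          ENNReal.ofReal_mul (by norm_num), ENNReal.ofReal_inv_of_pos hs', ENNReal.ofReal_natCast,
          ENNReal.ofReal_ofNat, ofReal_norm]
    _ ≤ (2 * (s : ℝ≥0∞)⁻¹) ^ 2 * (2 * (shiftAvg s (sqrtNorm (F (s + 1))) x
          + shiftAvg (k + 1) (sqrtNorm (F (s + 1))) x)) ^ 2 :=
        mul_le_mul_right (enorm_fejerMean_alpha_le hF hk x) _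
    _ = (4 * ((s : ℝ≥0∞)⁻¹ * shiftAvg s (sqrtNorm (F (s + 1))) x
          + (s : ℝ≥0∞)⁻¹ * shiftAvg (k + 1) (sqrtNorm (F (s + 1))) x)) ^ 2 := by ring
    _ ≤ (4 * (maximalBound F x + maximalBound F x)) ^ 2 := by
        gcongr <;> exact inv_mul_shiftAvg_le_maximalBound hF hs _ x
    _ = _ := by ring

/-! ### From the pointwise bound to the quasi-norm -/

theorem measurable_weightedMaximal (F : ℕ → DyadicGroup → 𝕜) :
    Measurable (weightedMaximal F) := by
  refine Measurable.iSup fun s => Measurable.iSup fun k => Measurable.iSup fun _ => ?_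
  refine Measurable.ennreal_ofReal (Measurable.div_const (Measurable.norm ?_) _)
  refine Measurable.const_mul (Finset.measurable_fun_sum _ fun n _ => ?_) _
  exact Finset.measurable_fun_sum _ fun i _ => (measurable_walsh i).smul_const _

theorem eLpNorm_one_half (f : DyadicGroup → ℝ≥0∞) :
    eLpNorm f (1 / 2) haarG = (∫⁻ x, f x ^ (1 / 2 : ℝ) ∂haarG) ^ 2 := by
  have h : (1 / 2 : ℝ≥0∞).toReal = 1 / 2 := by simp
  rw [eLpNorm_eq_lintegral_rpow_enorm_toReal (by simp) (by simp), h, one_div_one_div,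
    ← ENNReal.rpow_natCast]
  simp only [enorm_eq_self, Nat.cast_ofNat]

theorem eLpNorm_weightedMaximal_le {F : ℕ → DyadicGroup → 𝕜}
    (hF : Martingale F dyadicFiltration haarG) :
    eLpNorm (weightedMaximal F) (1 / 2) haarG
      ≤ (8 * (3 * (1 + geomConst) * geomConst)) ^ 2 * hardyNorm (1 / 2) F := by
  have hm : ∀ n, Measurable (F n) := fun n =>
    (hF.stronglyMeasurable n).measurable.mono (dyadicFiltration.le _) le_rfl
  rw [hardyNorm, eLpNorm_one_half, eLpNorm_one_half, ← mul_pow]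
  gcongr
  calc ∫⁻ x, weightedMaximal F x ^ (1 / 2 : ℝ) ∂haarG
      ≤ ∫⁻ x, 8 * maximalBound F x ∂haarG := by
        refine lintegral_mono fun x => ?_
        refine (ENNReal.rpow_le_rpow (weightedMaximal_le hF x) (by norm_num)).trans_eq ?_
        rw [← ENNReal.rpow_natCast, ← ENNReal.rpow_mul]
        norm_num
    _ ≤ _ := by
        rw [lintegral_const_mul' _ _ (by simp), mul_assoc]
        exact mul_le_mul_right (lintegral_maximalBound_le hm) _

end WalshFejer

theorem corollary3 (𝕜 : Type*) [RCLike 𝕜] :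
    ∃ c : ℝ≥0, ∀ F : ℕ → WalshFejer.DyadicGroup → 𝕜, WalshFejer.MemHardy (1 / 2) F →
      MemLp (WalshFejer.weightedMaximal F) (1 / 2) WalshFejer.haarG ∧
      eLpNorm (WalshFejer.weightedMaximal F) (1 / 2) WalshFejer.haarG
        ≤ c * WalshFejer.hardyNorm (1 / 2) F := by
  have hfin : (8 * (3 * (1 + WalshFejer.geomConst) * WalshFejer.geomConst)) ^ 2 ≠ ∞ := by
    have := WalshFejer.geomConst_ne_top
    finiteness
  refine ⟨((8 * (3 * (1 + WalshFejer.geomConst) * WalshFejer.geomConst)) ^ 2).toNNReal,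
    fun F hF => ?_⟩
  rw [ENNReal.coe_toNNReal hfin]
  have h := WalshFejer.eLpNorm_weightedMaximal_le hF.1
  exact ⟨⟨(WalshFejer.measurable_weightedMaximal F).aestronglyMeasurable,
    h.trans_lt (ENNReal.mul_lt_top hfin.lt_top hF.2)⟩, h⟩
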